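/- For an $n\times n$ complex matrix $A$, regarded as an operator on $\mathbb{C}^n$ with its standard inner product and norm, let $W(A)=\{\langle Ax,x\rangle : x\in\mathbb{C}^n,\ \|x\|=1\}$ be its numerical range, and let the ascent $a(A)$ be the smallest integer $k\ge 0$ with $\ker A^k=\ker A^{k+1}$. Call $A$ a partial isometry if $\|Ax\|=\|x\|$ for every $x\in(\ker A)^\perp$, and put $$p(A)=\sup\{k\ge 0 : I,A,A^2,\ldots,A^k \text{ are all partial isometries}\}\in\{0,1,2,\ldots\}\cup\{\infty\}.$$ **Proposition.** Let $A$ be an $n\times n$ complex matrix such that $W(A)$ is a circular disc centred at the origin, that is, $W(A)=\{z\in\mathbb{C} : |z|\le r\}$ for some $r\ge 0$, and suppose that $p(A)\ge a(A)-1$. Then $p(A)=a(A)$ or $p(A)=\infty$. -/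

import Mathlib

namespace PowPartialIso

/-- The linear map `x ↦ A x` on `ℂⁿ` with its standard inner product and norm. -/
noncomputable def op {n : ℕ} (A : Matrix (Fin n) (Fin n) ℂ) :
    EuclideanSpace ℂ (Fin n) →ₗ[ℂ] EuclideanSpace ℂ (Fin n) :=
  Matrix.toEuclideanLin A

/-- `A` is a partial isometry: `‖A x‖ = ‖x‖` for all `x` in the orthogonal complement of
`ker A`. -/
def IsPartialIsometry {n : ℕ} (A : Matrix (Fin n) (Fin n) ℂ) : Prop :=
  ∀ x ∈ (LinearMap.ker (op A))ᗮ, ‖op A x‖ = ‖x‖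

/-- The ascent `a(A)`: the minimal `k ≥ 0` with `ker A ^ k = ker A ^ (k + 1)`. -/
noncomputable def ascent {n : ℕ} (A : Matrix (Fin n) (Fin n) ℂ) : ℕ :=
  sInf {k : ℕ | LinearMap.ker (op (A ^ k)) = LinearMap.ker (op (A ^ (k + 1)))}

/-- The power partial isometry index `p(A)`: the supremum, in `{0, 1, 2, …, ∞}`, of all `k`
such that `I, A, A ^ 2, …, A ^ k` are all partial isometries. -/
noncomputable def powerIndex {n : ℕ} (A : Matrix (Fin n) (Fin n) ℂ) : ℕ∞ :=
  sSup ((fun k : ℕ => (k : ℕ∞)) '' {k : ℕ | ∀ j ≤ k, IsPartialIsometry (A ^ j)})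

/-- The numerical range `W(A) = {⟨A x, x⟩ : ‖x‖ = 1}`. Mathlib's inner product is
conjugate-linear in its first argument, so `⟨A x, x⟩` is written `inner ℂ x (A x)`. -/
def numRange {n : ℕ} (A : Matrix (Fin n) (Fin n) ℂ) : Set ℂ :=
  {z | ∃ x : EuclideanSpace ℂ (Fin n), ‖x‖ = 1 ∧ inner ℂ x (op A x) = z}

/-- `S` is a (closed) circular disc `{z : |z| ≤ r}` centred at the origin; the radius `r = 0`
is allowed. -/
def IsDiscAtOrigin (S : Set ℂ) : Prop :=
  ∃ r : ℝ, 0 ≤ r ∧ S = Metric.closedBall (0 : ℂ) r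

end PowPartialIso

/-! The index is in fact always infinite, because A^a(A) = 0. As W(A) is the disc of radius r, the
form 2r - zA - z̄A* is positive semidefinite and singular for every |z| = 1. For a partial isometry
T and σ ≠ 0, the Schur complement of σ + τT*T - zT - z̄T* over ker T has the same shape: T becomes
its compression to (ker T)ᗮ and (σ, τ) becomes (σ + τ - 1/σ, 1/σ). The sum σ + τ = 2r is preserved,
while the ascent drops by one and the partial isometry hypothesis is needed for one power fewer.

Once ker T = ker T², singularity at infinitely many z forces σ = 0
(`IsDegeneratePencil.false_of_ker_eq`), and positivity with r < 1 then gives T = 0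
(`IsDegeneratePencil.eq_zero`). If r ≥ 1, then σ > 1 persists through the reduction, so σ = 0 is
never reached. -/

namespace PowPartialIso

open scoped ComplexConjugate

/-! ### Degenerate pencils and the terminal case -/

section Pencil

variable {H : Type*} [NormedAddCommGroup H] [InnerProductSpace ℂ H] [FiniteDimensional ℂ H]

/-- The Hermitian forms `σ‖x‖² + τ‖T x‖² - 2 Re (z ⟪x, T x⟫)`, `‖z‖ = 1`, are all positive
semidefinite, and each of them is degenerate. -/
structure IsDegeneratePencil (T : H →ₗ[ℂ] H) (σ τ : ℝ) : Prop where
  re_le : ∀ z : ℂ, ‖z‖ = 1 → ∀ x : H,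
    2 * (z * inner ℂ x (T x)).re ≤ σ * ‖x‖ ^ 2 + τ * ‖T x‖ ^ 2
  exists_eq : ∀ z : ℂ, ‖z‖ = 1 → ∃ x : H, x ≠ 0 ∧ ∀ v : H,
    σ * inner ℂ v x + τ * inner ℂ (T v) (T x) = z * inner ℂ v (T x) + conj z * inner ℂ (T v) x

theorem infinite_norm_eq_one : {z : ℂ | ‖z‖ = 1}.Infinite := by
  have h : IsPreconnected (Metric.sphere (0 : ℂ) 1) :=
    isPreconnected_sphere (by simp [Complex.rank_real_complex]) 0 1
  have h2 : (Metric.sphere (0 : ℂ) 1).Infinite := by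
    apply h.infinite_of_nontrivial
    refine ⟨1, by simp, -1, by simp, ?_⟩
    intro h
    norm_num [Complex.ext_iff] at h
  convert h2 using 1
  ext z
  simp

theorem conj_mul_self_of_norm_eq_one {z : ℂ} (hz : ‖z‖ = 1) : conj z * z = 1 := by
  rw [Complex.conj_mul', hz]; simp

theorem exists_norm_eq_one_mul_eq_norm (w : ℂ) : ∃ z : ℂ, ‖z‖ = 1 ∧ z * w = ‖w‖ := by
  by_cases hw : w = 0
  · exact ⟨1, by simp [hw]⟩
  · refine ⟨conj w / ‖w‖, by simp [hw], ?_⟩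
    have : (‖w‖ : ℂ) ≠ 0 := by simpa using hw
    rw [div_mul_eq_mul_div, Complex.conj_mul']
    field_simp

/-- A quadratic pencil whose quadratic coefficient is invertible is singular only at finitely many
points, by passage to its companion operator. -/
theorem finite_setOf_quadratic_pencil_singular (L : H ≃ₗ[ℂ] H) (M N : H →ₗ[ℂ] H) :
    {z : ℂ | ‖z‖ = 1 ∧ ∃ y : H, y ≠ 0 ∧ z • L y = M y - conj z • N y}.Finite := by
  let Φ : Module.End ℂ (H × H) :=
    LinearMap.prod ((L.symm.toLinearMap ∘ₗ M) ∘ₗ LinearMap.fst ℂ H H -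
      (L.symm.toLinearMap ∘ₗ N) ∘ₗ LinearMap.snd ℂ H H) (LinearMap.fst ℂ H H)
  refine (Module.End.finite_hasEigenvalue Φ).subset ?_
  rintro z ⟨hz, y, hy, h⟩
  -- On the unit circle z̄ = 1/z, so (y, z̄y) linearises the quadratic equation.
  apply Module.End.hasEigenvalue_of_hasEigenvector (x := (y, conj z • y))
  refine ⟨Module.End.mem_eigenspace_iff.2 ?_, fun h0 => hy (by simpa using congrArg Prod.fst h0)⟩
  have h1 : z • y = L.symm (M y) - conj z • L.symm (N y) := by
    apply L.injective
    simpa using h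
  ext
  · simp [Φ, h1]
  · simp [Φ, smul_smul, mul_comm z, conj_mul_self_of_norm_eq_one hz]

/-- Projecting the null vector equation to ker T expresses Px through PTx. Eliminating Px leaves a
quadratic pencil in y = x - Px, which is singular at only finitely many z, whereas degeneracy holds
on the whole circle. -/
theorem IsDegeneratePencil.false_of_ker_eq {T : H →ₗ[ℂ] H} {σ τ : ℝ}
    (h : IsDegeneratePencil T σ τ) (hker : ∀ x, T (T x) = 0 → T x = 0)
    (hσ : σ ≠ 0 ∨ LinearMap.ker T = ⊥) : False := by
  set P : H →ₗ[ℂ] H := ((LinearMap.ker T).starProjection : H →L[ℂ] H).toLinearMap with hP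
  have hPmem : ∀ x, T (P x) = 0 := fun x =>
    LinearMap.mem_ker.1 (Submodule.starProjection_apply_mem _ x)
  have hPid : ∀ x, T x = 0 → P x = x := fun x hx =>
    (Submodule.starProjection_eq_self_iff).2 (LinearMap.mem_ker.2 hx)
  have hPsym : ∀ u v, inner ℂ (P u) v = inner ℂ u (P v) := fun u v =>
    Submodule.inner_starProjection_left_eq_right _ u v
  set S := LinearMap.adjoint T with hS
  have hPS : ∀ w, P (S w) = 0 := fun w => by
    refine ext_inner_left ℂ fun v => ?_
    rw [← hPsym, hS, LinearMap.adjoint_inner_right, hPmem]; simp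
  -- On (ker T)ᗮ this leading coefficient is (1 - P)T; adding P makes it invertible on all of H,
  -- using ker T² = ker T.
  have hinj : Function.Injective (P + T - P ∘ₗ T : H →ₗ[ℂ] H) := by
    refine (injective_iff_map_eq_zero _).2 fun v hv => ?_
    have hv' : P v + T v - P (T v) = 0 := by simpa using hv
    have h1 : P v = 0 := by
      have := congrArg P hv'
      simpa [hPid _ (hPmem v), hPid _ (hPmem (T v))] using this
    have h2 : T v = P (T v) := by
      rw [h1, zero_add] at hv'
      exact sub_eq_zero.1 hv'
    have h3 : T v = 0 := hker v (by rw [h2]; exact hPmem _)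
    rw [← hPid v h3, h1]
  refine infinite_norm_eq_one ((finite_setOf_quadratic_pencil_singular
    (LinearEquiv.ofInjectiveEndo _ hinj)
    ((σ : ℂ) • LinearMap.id + (τ : ℂ) • S ∘ₗ T - ((σ⁻¹ : ℝ) : ℂ) • S ∘ₗ P ∘ₗ T) S).subset ?_)
  rintro z (hz : ‖z‖ = 1)
  obtain ⟨x, hx, hv⟩ := h.exists_eq z hz
  have heq : (σ : ℂ) • x + (τ : ℂ) • S (T x) = z • T x + conj z • S x := by
    refine ext_inner_left ℂ fun v => ?_
    simpa only [inner_add_right, inner_smul_right, hS, LinearMap.adjoint_inner_right] using hv v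
  have hPx : (σ : ℂ) • P x = z • P (T x) := by
    simpa [hPS] using congrArg P heq
  have hPx' : P x = ((σ⁻¹ : ℝ) : ℂ) • z • P (T x) := by
    rcases hσ with hσ | hσ
    · rw [← hPx, smul_smul]
      simp [hσ]
    · have h0 : ∀ w, P w = 0 := fun w => by
        have : P w ∈ LinearMap.ker T := hPmem w
        simpa [hσ] using this
      simp [h0]
  have hT : T (x - P x) = T x := by simp [hPmem]
  refine ⟨hz, x - P x, fun h0 => hx ?_, ?_⟩
  · have h1 : T x = 0 := by rw [← hT, h0, map_zero]
    rw [h1] at hPx'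
    rw [sub_eq_zero.1 h0, hPx']; simp
  · have h1 : P (x - P x) = 0 := by simp [hPid _ (hPmem x)]
    have h2 : conj z • S (P x) = ((σ⁻¹ : ℝ) : ℂ) • S (P (T x)) := by
      rw [hPx', map_smul, map_smul, smul_comm, smul_smul (conj z),
        conj_mul_self_of_norm_eq_one hz, one_smul]
    simp only [LinearEquiv.coe_ofInjectiveEndo, LinearMap.sub_apply, LinearMap.add_apply,
      LinearMap.comp_apply, hT, h1, LinearMap.smul_apply, LinearMap.id_apply]
    rw [map_sub S, smul_sub (conj z), ← h2, smul_sub (σ : ℂ), hPx]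
    rw [smul_sub z, zero_add, eq_sub_of_add_eq heq.symm]
    module

/-- In the terminal case of the reduction, where the kernel of `T` is that of `T ^ 2`. -/
theorem IsDegeneratePencil.eq_zero {T : H →ₗ[ℂ] H} {σ τ r : ℝ}
    (h : IsDegeneratePencil T σ τ) (hker : ∀ x, T (T x) = 0 → T x = 0)
    (hr : σ + τ = 2 * r) (hσ : r < 1 ∨ 1 < σ)
    (hT : (∀ x, ‖T x‖ ≤ ‖x‖) ∨ τ = 0) : T = 0 := by
  have hσ0 : σ = 0 := by
    by_contra hne
    exact h.false_of_ker_eq hker (Or.inl hne)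
  subst hσ0
  have hr1 : r < 1 := hσ.resolve_right (by norm_num)
  have horth : ∀ k, T k = 0 → ∀ y, inner ℂ k (T y) = 0 := by
    intro k hk y
    by_contra hne
    obtain ⟨z, hz, hzw⟩ := exists_norm_eq_one_mul_eq_norm (inner ℂ k (T y))
    set C := τ * ‖T y‖ ^ 2 - 2 * (z * inner ℂ y (T y)).re with hC
    have hpos : 0 < ‖inner ℂ k (T y)‖ := norm_pos_iff.2 hne
    -- Along ck + y the left side grows linearly in c and the right side is constant; this c makes
    -- their difference 1.
    set c : ℝ := (C + 1) / (2 * ‖inner ℂ k (T y)‖) with hc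
    have h1 := h.re_le z hz ((c : ℂ) • k + y)
    have h2 : z * inner ℂ ((c : ℂ) • k + y) (T ((c : ℂ) • k + y)) =
        (c * ‖inner ℂ k (T y)‖ : ℝ) + z * inner ℂ y (T y) := by
      simp only [map_add, map_smul, hk, smul_zero, zero_add, inner_add_left, inner_smul_left,
        Complex.conj_ofReal]
      push_cast
      rw [← hzw]; ring
    rw [h2, Complex.add_re, Complex.ofReal_re] at h1
    simp only [map_add, map_smul, hk, smul_zero, zero_add, zero_mul] at h1
    have h3 : c * ‖inner ℂ k (T y)‖ = (C + 1) / 2 := by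
      rw [hc]; field_simp
    rw [h3] at h1
    linarith
  by_contra hne
  have hmaps : ∀ x, T x ∈ (LinearMap.ker T)ᗮ := fun x =>
    (Submodule.mem_orthogonal _ _).2 fun k hk => horth k hk x
  obtain ⟨x₀, hx₀⟩ : ∃ x, T x ≠ 0 := by
    by_contra! hall
    exact hne (LinearMap.ext hall)
  have : Nontrivial ((LinearMap.ker T)ᗮ : Submodule ℂ H) :=
    ⟨⟨⟨T x₀, hmaps x₀⟩, 0, fun h0 => hx₀ (by simpa using congrArg Subtype.val h0)⟩⟩
  obtain ⟨c, hc⟩ := Module.End.exists_eigenvalue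
    (T.restrict (p := (LinearMap.ker T)ᗮ) (q := (LinearMap.ker T)ᗮ) fun x _ => hmaps x)
  obtain ⟨⟨v, hvK⟩, hv⟩ := hc.exists_hasEigenvector
  have hv0 : v ≠ 0 := fun h0 => hv.2 (by simpa using h0)
  have hTv : T v = c • v := by simpa using congrArg Subtype.val hv.apply_eq_smul
  have hc0 : c ≠ 0 := by
    rintro rfl
    have : v ∈ LinearMap.ker T := by simpa using hTv
    exact hv0 (inner_self_eq_zero (𝕜 := ℂ).1 ((Submodule.mem_orthogonal _ _).1 hvK v this))
  -- Rotating c to |c| turns positivity at the eigenvector into τ|c| ≥ 2, against |c| ≤ 1 and τ = 2r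
  -- < 2, or against τ = 0.
  obtain ⟨z, hz, hzc⟩ := exists_norm_eq_one_mul_eq_norm c
  have h1 := h.re_le z hz v
  have h2 : z * inner ℂ v (T v) = (‖c‖ * ‖v‖ ^ 2 : ℝ) := by
    rw [hTv, inner_smul_right, ← mul_assoc, hzc, inner_self_eq_norm_sq_to_K]; simp
  rw [h2, Complex.ofReal_re, hTv, norm_smul] at h1
  have hvpos : 0 < ‖v‖ := norm_pos_iff.2 hv0
  have hcpos : 0 < ‖c‖ := norm_pos_iff.2 hc0
  have h3 : 2 ≤ τ * ‖c‖ := by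
    have hp : 0 < ‖c‖ * ‖v‖ ^ 2 := by positivity
    by_contra! hlt
    nlinarith
  rcases hT with hT | hT
  · have h4 := hT v
    rw [hTv, norm_smul] at h4
    have h5 : ‖c‖ ≤ 1 := by
      by_contra! hlt
      nlinarith
    nlinarith
  · rw [hT] at h3; linarith

end Pencil

/-! ### Compression to the orthogonal complement of the kernel -/

section Compression

variable {H : Type*} [NormedAddCommGroup H] [InnerProductSpace ℂ H]

/-- A linear map is isometric on the orthogonal complement of its kernel. -/
def IsIsometricOffKer (T : H →ₗ[ℂ] H) : Prop :=
  ∀ x ∈ (LinearMap.ker T)ᗮ, ‖T x‖ = ‖x‖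

theorem IsIsometricOffKer.inner_map_map {T : H →ₗ[ℂ] H} (hT : IsIsometricOffKer T)
    (u v : ((LinearMap.ker T)ᗮ : Submodule ℂ H)) :
    inner ℂ (T u) (T v) = inner ℂ (u : H) (v : H) :=
  (LinearMap.norm_map_iff_inner_map_map (T ∘ₗ (LinearMap.ker T)ᗮ.subtype)).1
    (fun y => hT y y.2) u v

variable [FiniteDimensional ℂ H]

/-- The compression of `T` to the orthogonal complement of its kernel. -/
noncomputable def kerCompression (T : H →ₗ[ℂ] H) :
    ((LinearMap.ker T)ᗮ : Submodule ℂ H) →ₗ[ℂ] ((LinearMap.ker T)ᗮ : Submodule ℂ H) :=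
  ((LinearMap.ker T)ᗮ.orthogonalProjectionOnto).toLinearMap ∘ₗ T ∘ₗ (LinearMap.ker T)ᗮ.subtype

theorem coe_kerCompression (T : H →ₗ[ℂ] H) (y : ((LinearMap.ker T)ᗮ : Submodule ℂ H)) :
    (kerCompression T y : H) = T y - (LinearMap.ker T).starProjection (T y) := by
  simp [kerCompression, Submodule.starProjection_orthogonal_val]

theorem map_starProjection_ker (T : H →ₗ[ℂ] H) (x : H) :
    T ((LinearMap.ker T).starProjection x) = 0 :=
  LinearMap.mem_ker.1 (Submodule.starProjection_apply_mem _ x)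

theorem coe_kerCompression_pow (T : H →ₗ[ℂ] H) (j : ℕ)
    (y : ((LinearMap.ker T)ᗮ : Submodule ℂ H)) :
    ((kerCompression T ^ j) y : H) = (T ^ j) y - (LinearMap.ker T).starProjection ((T ^ j) y) := by
  induction j with
  | zero =>
    have : (LinearMap.ker T).starProjection (y : H) = 0 :=
      (Submodule.starProjection_apply_eq_zero_iff _).2 y.2
    simp [this]
  | succ j ih =>
    rw [pow_succ', pow_succ', Module.End.mul_apply, Module.End.mul_apply, coe_kerCompression, ih,
      map_sub, map_starProjection_ker, sub_zero]

theorem kerCompression_pow_eq_zero_iff (T : H →ₗ[ℂ] H) (j : ℕ)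
    (y : ((LinearMap.ker T)ᗮ : Submodule ℂ H)) :
    (kerCompression T ^ j) y = 0 ↔ (T ^ (j + 1)) y = 0 := by
  rw [← Submodule.coe_eq_zero, coe_kerCompression_pow, sub_eq_zero, eq_comm,
    Submodule.starProjection_eq_self_iff, LinearMap.mem_ker, pow_succ', Module.End.mul_apply]

theorem IsIsometricOffKer.norm_sq {T : H →ₗ[ℂ] H} (hT : IsIsometricOffKer T) (x : H) :
    ‖T x‖ ^ 2 + ‖(LinearMap.ker T).starProjection x‖ ^ 2 = ‖x‖ ^ 2 := by
  have h := Submodule.norm_sq_eq_add_norm_sq_starProjection x (LinearMap.ker T)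
  have h1 := hT _ (Submodule.starProjection_apply_mem (LinearMap.ker T)ᗮ x)
  rw [Submodule.starProjection_orthogonal_val] at h1 h
  rw [map_sub, map_starProjection_ker, sub_zero] at h1
  rw [h, h1]; ring

theorem IsIsometricOffKer.norm_le {T : H →ₗ[ℂ] H} (hT : IsIsometricOffKer T) (x : H) :
    ‖T x‖ ≤ ‖x‖ := by
  have := hT.norm_sq x
  refine le_of_sq_le_sq ?_ (norm_nonneg _)
  nlinarith [sq_nonneg ‖(LinearMap.ker T).starProjection x‖]

theorem norm_sq_kerCompression (T : H →ₗ[ℂ] H) (y : ((LinearMap.ker T)ᗮ : Submodule ℂ H)) :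
    ‖T y‖ ^ 2 = ‖kerCompression T y‖ ^ 2 + ‖(LinearMap.ker T).starProjection (T y)‖ ^ 2 := by
  have h := Submodule.norm_sq_eq_add_norm_sq_starProjection (T y) (LinearMap.ker T)
  rw [Submodule.starProjection_orthogonal_val, ← coe_kerCompression] at h
  rw [h, Submodule.coe_norm]; ring

theorem IsIsometricOffKer.norm_kerCompression_le {T : H →ₗ[ℂ] H} (hT : IsIsometricOffKer T)
    (y : ((LinearMap.ker T)ᗮ : Submodule ℂ H)) : ‖kerCompression T y‖ ≤ ‖y‖ := by
  refine le_trans (le_of_sq_le_sq ?_ (norm_nonneg _)) (hT.norm_le y)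
  rw [norm_sq_kerCompression]
  nlinarith [sq_nonneg ‖(LinearMap.ker T).starProjection (T y)‖]

/-- With C the compression, T^(j+1) y = T(C^j y). As T and C are contractions, norm preservation by
T^(j+1) squeezes ‖C^j y‖ to ‖y‖. -/
theorem IsIsometricOffKer.kerCompression_pow {T : H →ₗ[ℂ] H} (hT : IsIsometricOffKer T) {j : ℕ}
    (hj : IsIsometricOffKer (T ^ (j + 1))) : IsIsometricOffKer (kerCompression T ^ j) := by
  have hle : ∀ i (y : ((LinearMap.ker T)ᗮ : Submodule ℂ H)),
      ‖(kerCompression T ^ i) y‖ ≤ ‖y‖ := by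
    intro i
    induction i with
    | zero => simp
    | succ i ih =>
      intro y
      rw [pow_succ', Module.End.mul_apply]
      exact (hT.norm_kerCompression_le _).trans (ih y)
  intro y hy
  refine le_antisymm (hle j y) ?_
  have hyK : (y : H) ∈ (LinearMap.ker (T ^ (j + 1)))ᗮ := by
    refine (Submodule.mem_orthogonal _ _).2 fun u hu => ?_
    set w : ((LinearMap.ker T)ᗮ : Submodule ℂ H) :=
      ⟨u - (LinearMap.ker T).starProjection u, Submodule.sub_starProjection_mem_orthogonal _⟩
    have hw : w ∈ LinearMap.ker (kerCompression T ^ j) := by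
      rw [LinearMap.mem_ker, kerCompression_pow_eq_zero_iff, pow_succ, Module.End.mul_apply]
      simp only [w, map_sub, map_starProjection_ker, sub_zero]
      rw [← Module.End.mul_apply, ← pow_succ]
      exact hu
    have h1 := (Submodule.mem_orthogonal _ _).1 hy w hw
    rw [Submodule.coe_inner, inner_sub_left,
      (Submodule.mem_orthogonal _ _).1 y.2 _ (Submodule.starProjection_apply_mem _ u),
      sub_zero] at h1
    exact h1
  calc ‖y‖ = ‖(T ^ (j + 1)) y‖ := (hj _ hyK).symm
    _ = ‖T ((kerCompression T ^ j) y)‖ := by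
      rw [coe_kerCompression_pow, map_sub, map_starProjection_ker, sub_zero, pow_succ',
        Module.End.mul_apply]
    _ ≤ _ := hT.norm_le _

/-- Schur complement of an operator pencil with respect to the kernel of a partial isometry. -/
theorem IsDegeneratePencil.kerCompression {T : H →ₗ[ℂ] H} {σ τ : ℝ}
    (h : IsDegeneratePencil T σ τ) (hT : IsIsometricOffKer T) (hσ : σ ≠ 0) :
    IsDegeneratePencil (kerCompression T) (σ + τ - σ⁻¹) σ⁻¹ := by
  set P := (LinearMap.ker T).starProjection with hP
  have hPmem : ∀ x, P x ∈ LinearMap.ker T := fun x => Submodule.starProjection_apply_mem _ x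
  have hTP : ∀ x, T (P x) = 0 := map_starProjection_ker T
  have hin : ∀ (y : ((LinearMap.ker T)ᗮ : Submodule ℂ H)) (w : H),
      inner ℂ (y : H) (P w) = 0 := fun y w =>
    Submodule.inner_left_of_mem_orthogonal (hPmem w) y.2
  have hin' : ∀ (y : ((LinearMap.ker T)ᗮ : Submodule ℂ H)) (w : H),
      inner ℂ (P w) (y : H) = 0 := fun y w =>
    Submodule.inner_right_of_mem_orthogonal (hPmem w) y.2
  have hcomp : ∀ y v : ((LinearMap.ker T)ᗮ : Submodule ℂ H),
      inner ℂ v (PowPartialIso.kerCompression T y) = inner ℂ (v : H) (T y) := fun y v => by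
    rw [Submodule.coe_inner, coe_kerCompression, inner_sub_right, hin, sub_zero]
  have hcomp' : ∀ y v : ((LinearMap.ker T)ᗮ : Submodule ℂ H),
      inner ℂ (PowPartialIso.kerCompression T v) y = inner ℂ (T v) (y : H) := fun y v => by
    rw [Submodule.coe_inner, coe_kerCompression, inner_sub_left, hin', sub_zero]
  have hσc : (σ : ℂ) ≠ 0 := by exact_mod_cast hσ
  constructor
  · intro z hz y
    set p := P (T y) with hp
    -- The kernel component cp is the stationary point of the form on y + ker T.
    set c : ℂ := z * (σ : ℂ)⁻¹ with hc
    have h1 := h.re_le z hz ((y : H) + c • p)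
    have hTx : T ((y : H) + c • p) = T y := by simp [hp, hTP]
    have hnc : ‖c‖ = |σ|⁻¹ := by simp [hc, hz]
    have hn : ‖(y : H) + c • p‖ ^ 2 = ‖y‖ ^ 2 + (σ⁻¹) ^ 2 * ‖p‖ ^ 2 := by
      have := norm_add_sq_eq_norm_sq_add_norm_sq_of_inner_eq_zero (y : H) (c • p)
        (by rw [inner_smul_right, hin, mul_zero])
      rw [pow_two, this, norm_smul, hnc, Submodule.coe_norm]
      rw [← abs_inv, ← sq_abs σ⁻¹]; ring
    have hpp : inner ℂ p (T y) = (‖p‖ ^ 2 : ℝ) := by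
      have : inner ℂ p (T y) = inner ℂ p p := by
        nth_rw 1 [hp]
        rw [hP, Submodule.inner_starProjection_left_eq_right, ← hP]
        nth_rw 1 [← (Submodule.starProjection_eq_self_iff).2 (hPmem (T y))]
        rw [← Submodule.inner_starProjection_left_eq_right]
      rw [this, inner_self_eq_norm_sq_to_K]; simp
    have hi : z * inner ℂ ((y : H) + c • p) (T y) =
        z * inner ℂ (y : H) (T y) + (σ⁻¹ * ‖p‖ ^ 2 : ℝ) := by
      rw [inner_add_left, inner_smul_left, hpp, hc, map_mul, map_inv₀, Complex.conj_ofReal]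
      push_cast
      linear_combination ((σ : ℂ)⁻¹ * ‖p‖ ^ 2) * conj_mul_self_of_norm_eq_one hz
    rw [hTx, hi, hn, hT y y.2, Complex.add_re, Complex.ofReal_re] at h1
    rw [hcomp]
    have h2 := norm_sq_kerCompression T y
    rw [hT y y.2] at h2
    have h3 : σ * ((σ⁻¹) ^ 2 * ‖p‖ ^ 2) = σ⁻¹ * ‖p‖ ^ 2 := by field_simp
    rw [← Submodule.coe_norm, ← hP, ← hp] at h2
    rw [← Submodule.coe_norm] at h1
    have h4 : ‖p‖ ^ 2 = ‖y‖ ^ 2 - ‖PowPartialIso.kerCompression T y‖ ^ 2 := by linarith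
    rw [mul_add σ, h3, h4] at h1
    linarith
  · intro z hz
    obtain ⟨x, hx, hv⟩ := h.exists_eq z hz
    obtain ⟨y, hy⟩ : ∃ y : ((LinearMap.ker T)ᗮ : Submodule ℂ H), (y : H) = x - P x :=
      ⟨⟨x - P x, Submodule.sub_starProjection_mem_orthogonal _⟩, rfl⟩
    have hTy : T y = T x := by simp [hy, hTP]
    -- Testing against kernel vectors determines the kernel part of the null vector.
    have hk : (σ : ℂ) • P x = z • P (T x) := by
      refine ext_inner_left ℂ fun v => ?_
      have := hv (P v)
      rw [hTP, inner_zero_left, inner_zero_left, mul_zero, mul_zero, add_zero, add_zero, hP,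
        Submodule.inner_starProjection_left_eq_right,
        Submodule.inner_starProjection_left_eq_right] at this
      rw [inner_smul_right, inner_smul_right, this]
    have hPx : P x = (z * (σ : ℂ)⁻¹) • P (T x) := by
      rw [mul_comm, mul_smul, ← hk, smul_smul, inv_mul_cancel₀ hσc, one_smul]
    refine ⟨y, fun h0 => hx ?_, fun v => ?_⟩
    · have h1 : T x = 0 := by rw [← hTy, h0]; simp
      have h2 : x - P x = 0 := by rw [← hy, h0]; simp
      rw [sub_eq_zero.1 h2, hPx, h1]; simp
    · have h1 := hv v
      have hxy : x = (y : H) + P x := by simp [hy]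
      have e1 : inner ℂ (v : H) x = inner ℂ (v : H) (y : H) := by
        rw [hxy, inner_add_right, hin, add_zero]
      have e2 : inner ℂ (T v) (T x) = inner ℂ (v : H) (y : H) := by
        rw [← hTy, hT.inner_map_map]
      have e3 : inner ℂ (T v) (P (T x)) = inner ℂ (v : H) (y : H) -
          inner ℂ (PowPartialIso.kerCompression T v) (PowPartialIso.kerCompression T y) := by
        rw [hcomp' (PowPartialIso.kerCompression T y) v, coe_kerCompression, inner_sub_right, hTy, e2]
        ring
      have e4 : inner ℂ (T v) x = inner ℂ (T v) (y : H) + z * (σ : ℂ)⁻¹ *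
          (inner ℂ (v : H) (y : H) -
          inner ℂ (PowPartialIso.kerCompression T v) (PowPartialIso.kerCompression T y)) := by
        rw [← e3, ← inner_smul_right, ← hPx, ← inner_add_right, ← hxy]
      have e5 : inner ℂ v y = inner ℂ (v : H) (y : H) := rfl
      rw [hcomp y v, hcomp' y v, hTy, e5]
      rw [e1, e2, e4] at h1
      push_cast
      linear_combination h1 + (σ : ℂ)⁻¹ * (inner ℂ (v : H) (y : H) -
          inner ℂ (PowPartialIso.kerCompression T v) (PowPartialIso.kerCompression T y)) *
          conj_mul_self_of_norm_eq_one hz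

/-- If σ ≤ 0, positivity on cTv + v would bound 2c by τ for every real c, where v is the part of u
orthogonal to ker T. -/
theorem IsDegeneratePencil.pos_of_ker_ne {T : H →ₗ[ℂ] H} {σ τ : ℝ}
    (h : IsDegeneratePencil T σ τ) (hT : IsIsometricOffKer T) {u : H} (hu : T u ≠ 0)
    (hu2 : T (T u) = 0) : 0 < σ := by
  by_contra! hσ
  set v := u - (LinearMap.ker T).starProjection u with hv
  have hvK : v ∈ (LinearMap.ker T)ᗮ := Submodule.sub_starProjection_mem_orthogonal _
  have hTv : T v = T u := by rw [hv, map_sub, map_starProjection_ker, sub_zero]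
  rw [← hTv] at hu hu2
  have horth : inner ℂ v (T v) = 0 :=
    Submodule.inner_left_of_mem_orthogonal (K := LinearMap.ker T) hu2 hvK
  have hn := hT v hvK
  have hpos : 0 < ‖v‖ := by rw [← hn]; exact norm_pos_iff.2 hu
  set c : ℝ := τ / 2 + 1
  have h1 := h.re_le 1 (by simp) ((c : ℂ) • T v + v)
  rw [map_add, map_smul, hu2, smul_zero, zero_add, inner_add_left, inner_smul_left, horth,
    inner_self_eq_norm_sq_to_K, add_zero, one_mul, Complex.conj_ofReal, hn] at h1
  have h2 : ((c : ℂ) * ((‖v‖ : ℝ) : ℂ) ^ 2).re = c * ‖v‖ ^ 2 := by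
    rw [← Complex.ofReal_pow, ← Complex.ofReal_mul, Complex.ofReal_re]
  have h3 : σ * ‖(c : ℂ) • T v + v‖ ^ 2 ≤ 0 := mul_nonpos_of_nonpos_of_nonneg hσ (sq_nonneg _)
  have h4 : 2 * (c * ‖v‖ ^ 2) ≤ σ * ‖(c : ℂ) • T v + v‖ ^ 2 + τ * ‖v‖ ^ 2 := by
    rw [← h2]; exact h1
  have h5 : 0 < ‖v‖ ^ 2 := by positivity
  simp only [c] at h4 h3
  nlinarith

end Compression

-- Induction on the ascent

universe u

theorem IsDegeneratePencil.pow_eq_zero (a : ℕ) : ∀ {H : Type u} [NormedAddCommGroup H]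
    [InnerProductSpace ℂ H] [FiniteDimensional ℂ H] {T : H →ₗ[ℂ] H} {σ τ r : ℝ},
    IsDegeneratePencil T σ τ → σ + τ = 2 * r → (r < 1 ∨ 1 < σ) →
    ((∀ x, ‖T x‖ ≤ ‖x‖) ∨ τ = 0) → (∀ j ≤ a, IsIsometricOffKer (T ^ j)) →
    (∀ x, (T ^ (a + 2)) x = 0 → (T ^ (a + 1)) x = 0) → T ^ (a + 1) = 0 := by
  induction a with
  | zero =>
    intro H _ _ _ T σ τ r h hr hσ hT _ hker
    rw [zero_add, pow_one]
    exact h.eq_zero (fun x hx => by simpa using hker x (by simpa [pow_succ] using hx)) hr hσ hT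
  | succ a ih =>
    intro H _ _ _ T σ τ r h hr hσ hT hiso hker
    by_cases hk : ∀ x, T (T x) = 0 → T x = 0
    · rw [h.eq_zero hk hr hσ hT]; simp
    push Not at hk
    obtain ⟨u, hu2, hu⟩ := hk
    have hT1 : IsIsometricOffKer T := by simpa using hiso 1 (by omega)
    have hpos := h.pos_of_ker_ne hT1 hu hu2
    have h' := h.kerCompression hT1 hpos.ne'
    have key := ih (r := r) h' (by rw [hr]; ring)
      -- If r ≥ 1 and σ > 1, the new coefficient 2r - 1/σ again exceeds 1.
      ((lt_or_ge r 1).imp_right fun h1 => by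
        have := inv_lt_one_of_one_lt₀ (hσ.resolve_left h1.not_gt)
        linarith)
      (Or.inl hT1.norm_kerCompression_le)
      (fun j hj => hT1.kerCompression_pow (hiso (j + 1) (by omega)))
      (fun y hy => by
        rw [kerCompression_pow_eq_zero_iff] at hy ⊢
        exact hker _ hy)
    ext x
    have h1 : x - (LinearMap.ker T).starProjection x ∈ (LinearMap.ker T)ᗮ :=
      Submodule.sub_starProjection_mem_orthogonal _
    have h2 := (kerCompression_pow_eq_zero_iff T (a + 1) ⟨_, h1⟩).1 (by rw [key]; simp)
    rw [pow_succ, Module.End.mul_apply] at h2 ⊢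
    simpa [map_starProjection_ker] using h2

/-! ### From matrices and numerical ranges to pencils -/

variable {n : ℕ} {A : Matrix (Fin n) (Fin n) ℂ}

theorem op_pow (A : Matrix (Fin n) (Fin n) ℂ) (k : ℕ) : op (A ^ k) = op A ^ k := by
  induction k with
  | zero =>
    ext x i
    simp [op]
  | succ k ih =>
    rw [pow_succ', pow_succ', ← ih]
    ext x i
    simp [op]

theorem ker_op_pow_ascent (A : Matrix (Fin n) (Fin n) ℂ) :
    LinearMap.ker (op A ^ ascent A) = LinearMap.ker (op A ^ (ascent A + 1)) := by
  have hne : {k : ℕ | LinearMap.ker (op (A ^ k)) = LinearMap.ker (op (A ^ (k + 1)))}.Nonempty := by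
    obtain ⟨k, -, hk⟩ := Module.End.exists_ker_pow_eq_ker_pow_succ (op A)
    exact ⟨k, by simpa [op_pow] using hk⟩
  have := Nat.sInf_mem hne
  change LinearMap.ker (op (A ^ ascent A)) = LinearMap.ker (op (A ^ (ascent A + 1))) at this
  rwa [op_pow, op_pow] at this

theorem isIsometricOffKer_zero {H : Type*} [NormedAddCommGroup H] [InnerProductSpace ℂ H] :
    IsIsometricOffKer (0 : H →ₗ[ℂ] H) := by
  intro x hx
  rw [LinearMap.ker_zero, Submodule.top_orthogonal_eq_bot, Submodule.mem_bot] at hx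
  simp [hx]

theorem isPartialIsometry_of_le_powerIndex {j : ℕ} (hj : (j : ℕ∞) ≤ powerIndex A) :
    IsPartialIsometry (A ^ j) := by
  rcases j with _ | j
  · intro x _
    rw [op_pow, pow_zero, Module.End.one_apply]
  · have : (j : ℕ∞) < powerIndex A := lt_of_lt_of_le (by exact_mod_cast j.lt_succ_self) hj
    obtain ⟨_, ⟨k, hk, rfl⟩, hjk⟩ := lt_sSup_iff.1 this
    exact hk _ (Nat.succ_le_of_lt (ENat.natCast_lt_natCast.1 hjk))

theorem powerIndex_eq_top (h : ∀ j, IsPartialIsometry (A ^ j)) : powerIndex A = ⊤ := by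
  refine (ENat.eq_top_iff_forall_ge).2 fun k => ?_
  exact le_sSup ⟨k, fun j _ => h j, rfl⟩

/-- A positive semidefinite Hermitian form vanishes identically against each of its isotropic
vectors. -/
theorem inner_map_eq_zero_of_isotropic {H : Type*} [NormedAddCommGroup H] [InnerProductSpace ℂ H]
    {S : H →ₗ[ℂ] H} (hS : S.IsPositive) {x : H}
    (hx : inner ℂ x (S x) = 0) : S x = 0 := by
  have hc := hS.re_inner_nonneg_right (S x)
  set c := RCLike.re (inner ℂ (S x) (S (S x))) with hcdef
  set b := ‖S x‖ ^ 2 with hb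
  have hb0 : 0 ≤ b := sq_nonneg _
  have key : ∀ t : ℝ, 0 ≤ t ^ 2 * c - 2 * t * b := by
    intro t
    have h1 := hS.re_inner_nonneg_right (x - (t : ℂ) • S x)
    have h2 : inner ℂ (x - (t : ℂ) • S x) (S (x - (t : ℂ) • S x)) =
        ((t ^ 2 : ℝ) : ℂ) * inner ℂ (S x) (S (S x)) - ((2 * t * b : ℝ) : ℂ) := by
      have h3 : inner ℂ (S x) (S x) = ((b : ℝ) : ℂ) := by
        rw [inner_self_eq_norm_sq_to_K, hb]; simp
      have h4 : inner ℂ x (S (S x)) = ((b : ℝ) : ℂ) := by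
        rw [← hS.isSymmetric, h3]
      simp only [map_sub, map_smul, inner_sub_left, inner_sub_right, inner_smul_left,
        inner_smul_right, hx, h3, h4, Complex.conj_ofReal]
      push_cast
      ring
    rw [h2, map_sub, RCLike.re_eq_complex_re, Complex.re_ofReal_mul, Complex.ofReal_re] at h1
    exact h1
  -- The minimiser b/c is shifted to b/(c + 1) to allow c = 0.
  have h1 := key (b / (c + 1))
  have h2 : (b / (c + 1)) ^ 2 * c - 2 * (b / (c + 1)) * b = -(b ^ 2 * (c + 2)) / (c + 1) ^ 2 := by
    have : c + 1 ≠ 0 := by positivity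
    field_simp
    ring
  have h3 : b ^ 2 * (c + 2) ≤ 0 := by
    rw [h2, le_div_iff₀ (by positivity)] at h1
    linarith
  have h4 : b = 0 := by
    by_contra hne
    have : 0 < b ^ 2 * (c + 2) := by positivity
    linarith
  simpa [hb] using h4

theorem isDegeneratePencil_of_numRange_eq {r : ℝ} (hr : 0 ≤ r)
    (hW : numRange A = Metric.closedBall 0 r) : IsDegeneratePencil (op A) (2 * r) 0 := by
  have hle : ∀ z : ℂ, ‖z‖ = 1 → ∀ x, (z * inner ℂ x (op A x)).re ≤ r * ‖x‖ ^ 2 := by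
    intro z hz x
    by_cases hx : x = 0
    · simp [hx]
    have hxn : ‖x‖ ≠ 0 := norm_ne_zero_iff.2 hx
    have hmem : inner ℂ (((‖x‖⁻¹ : ℝ) : ℂ) • x) (op A (((‖x‖⁻¹ : ℝ) : ℂ) • x)) ∈ numRange A :=
      ⟨_, by rw [norm_smul, Complex.norm_real, norm_inv, norm_norm, inv_mul_cancel₀ hxn], rfl⟩
    rw [hW, mem_closedBall_zero_iff, map_smul, inner_smul_left, inner_smul_right, norm_mul,
      norm_mul, Complex.norm_conj, Complex.norm_real, norm_inv, norm_norm] at hmem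
    have h1 : ‖inner ℂ x (op A x)‖ ≤ r * ‖x‖ ^ 2 := by
      have hpos : 0 < ‖x‖ ^ 2 := by positivity
      rw [← mul_assoc, ← mul_inv, ← pow_two, inv_mul_le_iff₀ hpos] at hmem
      linarith
    calc (z * inner ℂ x (op A x)).re ≤ ‖z * inner ℂ x (op A x)‖ := Complex.re_le_norm _
      _ = ‖inner ℂ x (op A x)‖ := by rw [norm_mul, hz, one_mul]
      _ ≤ _ := h1
  refine ⟨fun z hz x => by linarith [hle z hz x], fun z hz => ?_⟩
  -- The boundary point r z̄ of the disc is where Re(z⟨Ax, x⟩) attains r; its unit vector is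
  -- isotropic for the form.
  have hmem : (r : ℂ) * conj z ∈ numRange A := by
    rw [hW, mem_closedBall_zero_iff, norm_mul, Complex.norm_conj, hz, mul_one, Complex.norm_real,
      Real.norm_of_nonneg hr]
  obtain ⟨x, hx1, hx⟩ := hmem
  set S : EuclideanSpace ℂ (Fin n) →ₗ[ℂ] EuclideanSpace ℂ (Fin n) :=
    ((2 * r : ℝ) : ℂ) • LinearMap.id - (z • op A + conj z • LinearMap.adjoint (op A)) with hSdef
  have hSv : ∀ v y, inner ℂ v (S y) = ((2 * r : ℝ) : ℂ) * inner ℂ v y -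
      (z * inner ℂ v (op A y) + conj z * inner ℂ (op A v) y) := fun v y => by
    simp only [hSdef, LinearMap.sub_apply, LinearMap.add_apply, LinearMap.smul_apply,
      LinearMap.id_apply, inner_sub_right, inner_add_right, inner_smul_right,
      LinearMap.adjoint_inner_right]
  have hS : S.IsPositive := by
    refine ⟨fun u v => ?_, fun y => ?_⟩
    · rw [← inner_conj_symm, hSv, hSv]
      simp only [map_sub, map_mul, map_add, inner_conj_symm, Complex.conj_conj,
        Complex.conj_ofReal]
      ring
    · rw [← inner_conj_symm, hSv, ← inner_conj_symm (op A y) y, ← map_mul]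
      simp only [RCLike.conj_re, RCLike.re_eq_complex_re]
      have h1 := hle z hz y
      have h2 : inner ℂ y y = ((‖y‖ ^ 2 : ℝ) : ℂ) := by
        rw [inner_self_eq_norm_sq_to_K]; simp
      rw [h2, ← Complex.ofReal_mul, Complex.sub_re, Complex.add_re, Complex.ofReal_re,
        Complex.conj_re]
      linarith
  have hSx : S x = 0 := by
    refine inner_map_eq_zero_of_isotropic hS ?_
    rw [hSv, ← inner_conj_symm (op A x) x, hx, inner_self_eq_norm_sq_to_K, hx1]
    simp only [map_mul, Complex.conj_conj, Complex.conj_ofReal]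
    push_cast
    linear_combination (-2 * (r : ℂ)) * conj_mul_self_of_norm_eq_one hz
  refine ⟨x, fun h0 => by simp [h0] at hx1, fun v => ?_⟩
  have := hSv v x
  rw [hSx, inner_zero_right] at this
  rw [Complex.ofReal_zero, zero_mul, add_zero]
  exact sub_eq_zero.1 this.symm

end PowPartialIso

open PowPartialIso
theorem proposition2p11 (n : ℕ) (A : Matrix (Fin n) (Fin n) ℂ)
    (hW : PowPartialIso.IsDiscAtOrigin (PowPartialIso.numRange A))
    (hp : (PowPartialIso.ascent A : ℕ∞) ≤ PowPartialIso.powerIndex A + 1) :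
    PowPartialIso.powerIndex A = (PowPartialIso.ascent A : ℕ∞) ∨
      PowPartialIso.powerIndex A = ⊤ := by
  right
  obtain ⟨r, hr, hW⟩ := hW
  have hpencil := isDegeneratePencil_of_numRange_eq hr hW
  have hker := ker_op_pow_ascent A
  rcases ha : ascent A with _ | a
  -- Ascent zero makes A injective, which contradicts degeneracy even if r = 0.
  · have hbot : LinearMap.ker (op A) = ⊥ := by
      rw [ha, zero_add, pow_one, pow_zero] at hker
      rw [← hker]
      exact LinearMap.ker_id
    exact (hpencil.false_of_ker_eq (fun x hx => LinearMap.ker_eq_bot'.1 hbot _ hx)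
      (Or.inr hbot)).elim
  rw [ha] at hp hker
  have hpa : (a : ℕ∞) ≤ powerIndex A := by
    push_cast at hp
    exact (ENat.add_le_add_iff_right ENat.one_ne_top).1 hp
  have hiso : ∀ j ≤ a, IsIsometricOffKer (op A ^ j) := fun j hj => by
    rw [← op_pow]
    exact isPartialIsometry_of_le_powerIndex (le_trans (by exact_mod_cast hj) hpa)
  have hzero : op A ^ (a + 1) = 0 := by
    refine hpencil.pow_eq_zero a (r := r) (by ring) ?_ (Or.inr rfl) hiso fun x hx => ?_
    · rcases lt_or_ge r 1 with h | h
      · exact Or.inl h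
      · exact Or.inr (by linarith)
    · rw [← LinearMap.mem_ker, hker]
      exact hx
  refine powerIndex_eq_top fun j => ?_
  change IsIsometricOffKer (op (A ^ j))
  rw [op_pow]
  rcases le_or_gt j a with hj | hj
  · exact hiso j hj
  · rw [pow_eq_zero_of_le (Nat.succ_le_of_lt hj) hzero]
    exact isIsometricOffKer_zero
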